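/- Let $p$ be a prime and $k$ an algebraically closed field of characteristic $p$. Let $X,Y,H$ be the standard basis of $\mathfrak{sl}_2(\mathbb{C})$ (so $[H,X]=2X$, $[H,Y]=-2Y$, $[X,Y]=H$), let $\mathcal{U}_{\mathbb{Z}}$ be the subring of the universal enveloping algebra of $\mathfrak{sl}_2(\mathbb{C})$ generated by all $X^{(m)}=X^m/m!$ and $Y^{(m)}=Y^m/m!$ with $m\ge 0$, and let $\mathcal{U}=\mathcal{U}_{\mathbb{Z}}\otimes_{\mathbb{Z}}k$ be the hyperalgebra of $\mathrm{SL}_2(k)$. For $c\in\mathbb{Z}$ and $n\ge 0$ put $\binom{H+c}{n}=(H+c)(H+c-1)\cdots(H+c-n+1)/n!\in\mathcal{U}_{\mathbb{Z}}$; the same notation is used for the images of elements of $\mathcal{U}_{\mathbb{Z}}$ in $\mathcal{U}$. The elements $Y^{(m)}\binom{H}{n}X^{(m')}$ $(m,n,m'\ge 0)$ form a $k$-basis of $\mathcal{U}$; let $\mathrm{Fr}':\mathcal{U}\to\mathcal{U}$ be the $k$-linear map with $Y^{(m)}\binom{H}{n}X^{(m')}\mapsto Y^{(mp)}\binom{H}{np}X^{(m'p)}$.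 For $a\in\mathbb{Z}$ put $\mu_a=\binom{H-a-1}{p-1}\in\mathcal{U}$. *Parameters.* If $p$ is odd, let $\mathcal{P}=\{0,\dots,p-1\}\times\{0,\dots,(p-1)/2\}$; if $p=2$, let $\mathcal{P}=\{(0,1/2),(1,0),(1,1)\}$. *The elements $B^{(\varepsilon)}(a,j)$ for $(a,j)\in\mathcal{P}$, $\varepsilon\in\{0,1\}$.* If $p$ is odd, define in $\mathbb{F}_p[x]$ the polynomials $\varphi_{a,m}(x)=\prod_{i=0}^{m-1}(x-i(i+a+1))$, $\psi(x)=\prod_{i\in\mathbb{F}_p}(x-i^2)$, $\psi^{(1)}_j(x)=\psi(x)/(x-j^2)$, $\psi_0^{(0)}(x)=\prod_{i\in\mathbb{F}_p^\times}(x-i^2)$ and, for $j\ne0$, $\psi_j^{(0)}(x)=2x(x+j^2)\prod_{i\in\mathbb{F}_p^\times\setminus\{j,-j\}}(x-i^2)$; set $$B^{(\varepsilon)}(a,j)=\psi_j^{(\varepsilon)}\Big(\mu_aYX+\big(\tfrac{a+1}{2}\big)^2\Big)\mu_a,$$ and let $n^{(\varepsilon)}(a,j)$ be the largest $n\ge0$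 with $\varphi_{a,n}(x)\mid\psi_j^{(\varepsilon)}\big(x+(\tfrac{a+1}{2})^2\big)$. If $p=2$, set $B^{(0)}(0,\frac12)=\mu_0$, $B^{(1)}(0,\frac12)=\mu_0YX$, $B^{(\varepsilon)}(1,0)=\mu_1YX$, $B^{(\varepsilon)}(1,1)=\mu_1YX+\mu_1$, and $n^{(\varepsilon)}(0,\frac12)=\varepsilon$, $n^{(\varepsilon)}(1,0)=1$, $n^{(\varepsilon)}(1,1)=0$. In all cases there are unique $c_m^{(\varepsilon)}\in\mathbb{F}_p$ with $B^{(\varepsilon)}(a,j)=\mu_a\sum_{m=n^{(\varepsilon)}(a,j)}^{p-1}c^{(\varepsilon)}_mY^mX^m$. *The maps $Z^{(\varepsilon)}$.* Consider the conditions (A): $a$ is even and $(p-a+1)/2\le j\le(p-1)/2$; (C): $a$ is odd and $0\le j\le(a-1)/2$. If $(a,j)\in\mathcal{P}$ satisfies (A) or (C), let $s(a,j)$ be $(p-a+1)/2$ if $p$ is odd and $a$ is even, $(p-a)/2$ if $p$ and $a$ are odd, and $1$ if $p=2$, and put $$Z^{(\varepsilon)}(z;(a,j))=\mu_a\sum_{m=n^{(\varepsilon)}(a,j)}^{p-1}c_m^{(\varepsilon)}Y^mX^{m-s(a,j)}\,\mathrm{Fr}'(z)\,X^{s(a,j)}\qquad(z\in\mathcal{U});$$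 otherwise put $Z^{(\varepsilon)}(z;(a,j))=\mathrm{Fr}'(z)B^{(\varepsilon)}(a,j)$. *The elements $B^{(\boldsymbol\varepsilon)}(\boldsymbol a,\boldsymbol j)$.* For $r\ge1$, $\boldsymbol\varepsilon=(\varepsilon_0,\dots,\varepsilon_{r-1})\in\{0,1\}^r$ and $(\boldsymbol a,\boldsymbol j)=((a_i,j_i))_{i=0}^{r-1}\in\mathcal{P}^r$, let $B^{(\boldsymbol\varepsilon)}(\boldsymbol a,\boldsymbol j)=B^{(\varepsilon_0)}(a_0,j_0)$ if $r=1$, and $$B^{(\boldsymbol\varepsilon)}(\boldsymbol a,\boldsymbol j)=Z^{(\varepsilon_0)}\Big(B^{(\varepsilon_1,\dots,\varepsilon_{r-1})}\big((a_1,\dots,a_{r-1}),(j_1,\dots,j_{r-1})\big);(a_0,j_0)\Big)$$ if $r\ge2$. **Proposition.** Let $r\ge1$, $\boldsymbol\varepsilon,\tilde{\boldsymbol\varepsilon}\in\{0,1\}^r$ and $(\boldsymbol a,\boldsymbol j)\in\mathcal{P}^r$. If $\varepsilon_s=\tilde\varepsilon_s$ for every $s\in\{0,\dots,r-1\}$ with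 $j_s\ne0$ (when $p$ is odd), respectively with $a_s\ne1$ (when $p=2$), then $$B^{(\boldsymbol\varepsilon)}(\boldsymbol a,\boldsymbol j)=B^{(\tilde{\boldsymbol\varepsilon})}(\boldsymbol a,\boldsymbol j).$$ In particular, $B^{(\boldsymbol\varepsilon)}(\boldsymbol a,\boldsymbol j)$ does not change if every $\varepsilon_s$ with $j_s=0$ ($p$ odd), respectively with $a_s=1$ ($p=2$), is replaced by $0$. -/

import Mathlib

noncomputable section
namespace SL2Hyper
open Polynomial
open scoped Nat TensorProduct

section DividedPowers
variable {A : Type*} [Ring A] [Algebra ℂ A]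

/-- The divided power `x ^ m / m!`. -/
def divPow (x : A) (m : ℕ) : A := ((m ! : ℂ)⁻¹) • x ^ m

/-- The binomial coefficient `x (x - 1) ⋯ (x - n + 1) / n!`. -/
def binom (x : A) (n : ℕ) : A := ((n ! : ℂ)⁻¹) • aeval x (descPochhammer ℂ n)

/-- Divided powers extended by zero to negative exponents (auxiliary). -/
def divPowZ (x : A) : ℤ → A
  | (m : ℕ) => divPow x m
  | Int.negSucc _ => 0

theorem divPowZ_natCast (x : A) (m : ℕ) : divPowZ x (m : ℤ) = divPow x m := rfl

theorem divPowZ_neg_one (x : A) : divPowZ x (-1) = 0 := rfl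

theorem divPow_zero (x : A) : divPow x 0 = 1 := by simp [divPow]

theorem divPow_one (x : A) : divPow x 1 = x := by simp [divPow]

theorem binom_zero (x : A) : binom x 0 = 1 := by simp [binom]

theorem mul_divPow (x : A) (m : ℕ) : x * divPow x m = ((m : ℂ) + 1) • divPow x (m + 1) := by
  have h : ((m : ℂ) + 1) ≠ 0 := by exact_mod_cast Nat.succ_ne_zero m
  simp only [divPow, mul_smul_comm, smul_smul, Nat.factorial_succ, pow_succ']
  congr 1
  push_cast
  field_simp

theorem divPow_mul (x : A) (m : ℕ) : divPow x m * x = ((m : ℂ) + 1) • divPow x (m + 1) := by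
  rw [← mul_divPow]
  simp only [divPow, mul_smul_comm, smul_mul_assoc, ← pow_succ, ← pow_succ']

theorem mul_divPowZ (x : A) (m : ℤ) : x * divPowZ x m = ((m : ℂ) + 1) • divPowZ x (m + 1) := by
  match m with
  | (m : ℕ) =>
    rw [← Nat.cast_succ, divPowZ_natCast, divPowZ_natCast, mul_divPow]; simp
  | Int.negSucc 0 => simp [divPowZ]
  | Int.negSucc (n + 1) =>
    have : Int.negSucc (n + 1) + 1 = Int.negSucc n := by omega
    rw [this]; simp [divPowZ]

theorem divPow_mul_divPow (x : A) (i m : ℕ) :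
    divPow x i * divPow x m = (((i + m).choose i : ℕ) : ℤ) • divPow x (i + m) := by
  rw [← Int.cast_smul_eq_zsmul ℂ]
  simp only [divPow, mul_smul_comm, smul_mul_assoc, smul_smul, ← pow_add]
  congr 1
  have h1 : ((i ! : ℕ) : ℂ) ≠ 0 := by exact_mod_cast i.factorial_ne_zero
  have h2 : ((m ! : ℕ) : ℂ) ≠ 0 := by exact_mod_cast m.factorial_ne_zero
  have h3 : (((i + m)! : ℕ) : ℂ) ≠ 0 := by exact_mod_cast (i + m).factorial_ne_zero
  have := Nat.add_choose_mul_factorial_mul_factorial i m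
  have h : (((i + m).choose i : ℕ) : ℂ) * (i ! : ℕ) * (m ! : ℕ) = ((i + m)! : ℕ) := by
    rw [← Nat.choose_symm_add] at this; exact_mod_cast this
  field_simp
  push_cast
  linear_combination -h

theorem succ_smul_binom_succ (x : A) (n : ℕ) :
    ((n : ℂ) + 1) • binom x (n + 1) = binom x n * (x - (n : A)) := by
  have h : ((n : ℂ) + 1) ≠ 0 := by exact_mod_cast Nat.succ_ne_zero n
  simp only [binom, descPochhammer_succ_right, smul_smul, Nat.factorial_succ, map_mul,
    smul_mul_assoc, map_sub, aeval_X, map_natCast]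
  congr 1
  push_cast
  field_simp

theorem binom_succ (x : A) (n : ℕ) :
    binom x (n + 1) = ((n : ℂ) + 1)⁻¹ • (binom x n * (x - (n : A))) := by
  have h : ((n : ℂ) + 1) ≠ 0 := by exact_mod_cast Nat.succ_ne_zero n
  rw [← succ_smul_binom_succ, smul_smul, inv_mul_cancel₀ h, one_smul]

theorem binom_add_one (x : A) (n : ℕ) :
    binom (x + 1) (n + 1) = binom x (n + 1) + binom x n := by
  have h : ((n : ℂ) + 1) ≠ 0 := by exact_mod_cast Nat.succ_ne_zero n
  have h2 : ((n ! : ℕ) : ℂ) ≠ 0 := by exact_mod_cast n.factorial_ne_zero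
  have key : aeval (x + 1) (descPochhammer ℂ (n + 1)) = (x + 1) * aeval x (descPochhammer ℂ n) := by
    rw [descPochhammer_succ_left, map_mul, aeval_X, aeval_comp]
    simp
  have key2 : (aeval x (descPochhammer ℂ n)) * x = x * aeval x (descPochhammer ℂ n) := by
    have := congrArg (aeval x) (mul_comm (descPochhammer ℂ n) X)
    simpa using this
  rw [binom_succ x n]
  have e : ((n ! : ℕ) : ℂ)⁻¹ = (((n + 1)! : ℕ) : ℂ)⁻¹ * ((n : ℂ) + 1) := by
    rw [Nat.factorial_succ]; push_cast; field_simp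
  have e' : ((n : ℂ) + 1)⁻¹ * ((n ! : ℕ) : ℂ)⁻¹ = (((n + 1)! : ℕ) : ℂ)⁻¹ := by
    rw [e]; field_simp
  rw [binom, binom, key, smul_mul_assoc, smul_smul, e', e, mul_smul, ← smul_add]
  congr 1
  rw [mul_sub, key2, add_smul, one_smul, add_mul, one_mul, ← Nat.cast_comm, ← nsmul_eq_mul,
    Nat.cast_smul_eq_nsmul]
  abel

theorem commute_binom (x : A) (c : ℤ) (n : ℕ) : Commute x (binom (x + (c : A)) n) := by
  induction n with
  | zero => simp [binom_zero]
  | succ n ih =>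
    rw [binom_succ]
    refine Commute.smul_right (ih.mul_right ?_) _
    exact ((Commute.refl x).add_right (Int.cast_commute c x).symm).sub_right
      (Nat.cast_commute n x).symm

theorem binom_mul_binom_sub (x : A) (t i : ℕ) :
    binom x t * binom (x - (t : A)) i = (((t + i).choose t : ℕ) : ℤ) • binom x (t + i) := by
  have key : aeval x (descPochhammer ℂ t) * aeval (x - (t : A)) (descPochhammer ℂ i)
      = aeval x (descPochhammer ℂ (t + i)) := by
    rw [← descPochhammer_mul, map_mul, aeval_comp]; simp
  rw [← Int.cast_smul_eq_zsmul ℂ]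
  simp only [binom, mul_smul_comm, smul_mul_assoc, smul_smul, key]
  congr 1
  have h1 : ((t ! : ℕ) : ℂ) ≠ 0 := by exact_mod_cast t.factorial_ne_zero
  have h2 : ((i ! : ℕ) : ℂ) ≠ 0 := by exact_mod_cast i.factorial_ne_zero
  have h3 : (((t + i)! : ℕ) : ℂ) ≠ 0 := by exact_mod_cast (t + i).factorial_ne_zero
  have := Nat.add_choose_mul_factorial_mul_factorial t i
  have h : (((t + i).choose t : ℕ) : ℂ) * (t ! : ℕ) * (i ! : ℕ) = ((t + i)! : ℕ) := by
    rw [← Nat.choose_symm_add] at this; exact_mod_cast this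
  field_simp
  push_cast
  linear_combination -h

/-- Any subgroup containing all `binom x n` contains all `binom (x + c) n` for integers `c`. -/
theorem binom_add_int_mem (S : AddSubgroup A) (x : A) (N : ℕ) (h : ∀ n ≤ N, binom x n ∈ S) (c : ℤ) :
    ∀ n ≤ N, binom (x + (c : A)) n ∈ S := by
  induction c using Int.induction_on with
  | zero => simpa using h
  | succ c ih =>
    intro n hn
    cases n with
    | zero => simpa [binom_zero] using h 0 (Nat.zero_le _)
    | succ n =>
      have : x + (((c : ℤ) + 1 : ℤ) : A) = (x + ((c : ℤ) : A)) + 1 := by push_cast; abel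
      rw [this, binom_add_one]
      exact S.add_mem (ih _ hn) (ih _ (by omega))
  | pred c ih =>
    intro n
    induction n with
    | zero => intro _; simpa [binom_zero] using h 0 (Nat.zero_le _)
    | succ n ih2 =>
      intro hn
      have e : x + ((-(c : ℤ) : ℤ) : A) = (x + ((-(c : ℤ) - 1 : ℤ) : A)) + 1 := by push_cast; abel
      have := binom_add_one (x + ((-(c : ℤ) - 1 : ℤ) : A)) n
      rw [← e] at this
      rw [← sub_eq_of_eq_add this]
      exact S.sub_mem (ih _ hn) (ih2 (by omega))

end DividedPowers

section Commutation
variable {A : Type*} [Ring A] [Algebra ℂ A] {x y h : A}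

theorem binom_semiconj {z : A} {k : ℤ} (hz : h * z = z * (h + (k : A))) (c : ℤ) (t : ℕ) :
    binom (h + (c : A)) t * z = z * binom (h + ((c + k : ℤ) : A)) t := by
  induction t with
  | zero => simp [binom_zero]
  | succ t ih =>
    have h1 : (h + (c : A) - (t : A)) * z = z * (h + ((c + k : ℤ) : A) - (t : A)) := by
      have e1 := (Int.cast_commute c z).eq
      have e2 := (Nat.cast_commute t z).eq
      rw [sub_mul, add_mul, hz, e1, e2]; push_cast; noncomm_ring
    rw [binom_succ, binom_succ, smul_mul_assoc, mul_assoc, h1, ← mul_assoc, ih, mul_assoc,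
      mul_smul_comm]

theorem semiconj_divPow {z : A} {k : ℤ} (hz : h * z = z * (h + (k : A))) (m : ℕ) :
    h * divPow z m = divPow z m * (h + ((m * k : ℤ) : A)) := by
  have : h * z ^ m = z ^ m * (h + ((m * k : ℤ) : A)) := by
    induction m with
    | zero => simp
    | succ m ih =>
      have e := (Int.cast_commute (m * k) z).eq
      rw [pow_succ, ← mul_assoc, ih, mul_assoc, add_mul, hz, e]
      push_cast; noncomm_ring
  rw [divPow, mul_smul_comm, this, smul_mul_assoc]

theorem x_mul_divPow_y (hy : h * y = y * (h + ((-2 : ℤ) : A))) (hxy : x * y = y * x + h) (m : ℤ) :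
    x * divPowZ y m = divPowZ y m * x + divPowZ y (m - 1) * (h - (m : A) + 1) := by
  match m with
  | Int.negSucc n =>
    have : Int.negSucc n - 1 = Int.negSucc (n + 1) := by omega
    rw [this]; simp [divPowZ]
  | (m : ℕ) =>
    induction m with
    | zero => simp [show divPowZ y 0 = 1 from divPow_zero y, divPowZ_neg_one]
    | succ m ih =>
      have hne : ((m : ℂ) + 1) ≠ 0 := by exact_mod_cast Nat.succ_ne_zero m
      have e1 : ((m : ℂ) + 1) • divPowZ y ((m + 1 : ℕ) : ℤ) = y * divPowZ y (m : ℤ) := by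
        rw [mul_divPowZ]; simp
      have e2 : y * divPowZ y ((m : ℤ) - 1) = (m : ℂ) • divPowZ y (m : ℤ) := by
        rw [mul_divPowZ]; simp
      have e3 := semiconj_divPow hy m
      refine (smul_right_injective A hne) ?_
      have s : ((m + 1 : ℕ) : ℤ) - 1 = m := by push_cast; ring
      simp only [s]
      have l : ((m : ℂ) + 1) • (x * divPowZ y ((m + 1 : ℕ) : ℤ)) = y * (x * divPowZ y (m : ℤ))
          + h * divPowZ y (m : ℤ) := by
        rw [← mul_smul_comm, e1, ← mul_assoc, hxy, add_mul, mul_assoc]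
      have r : ((m : ℂ) + 1) • (divPowZ y ((m + 1 : ℕ) : ℤ) * x) = y * divPowZ y (m : ℤ) * x := by
        rw [← smul_mul_assoc, e1]
      rw [l, smul_add, r, ih, mul_add, ← mul_assoc, ← mul_assoc, e2, add_assoc, divPowZ_natCast, e3,
        ← Nat.cast_succ, Nat.cast_smul_eq_nsmul, Nat.cast_smul_eq_nsmul,
        nsmul_eq_mul, nsmul_eq_mul, (Nat.cast_commute m (divPow y m)).eq, mul_assoc, mul_assoc,
        ← mul_assoc (m.succ : A), (Nat.cast_commute m.succ (divPow y m)).eq, mul_assoc]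
      congr 1
      have c := Nat.cast_comm m h
      have c' : ((m + 1 : ℕ) : A) * (h - (((m + 1 : ℕ) : ℤ) : A) + 1)
          = (m : A) * (h - ((m : ℤ) : A) + 1) + (h + ((m * -2 : ℤ) : A)) := by
        push_cast
        noncomm_ring
      rw [Nat.succ_eq_add_one, c', mul_add (divPow y m) ((m : A) * _)]

theorem commutation (hx : h * x = x * (h + ((2 : ℤ) : A))) (hy : h * y = y * (h + ((-2 : ℤ) : A)))
    (hxy : x * y = y * x + h) (i m : ℕ) :
    divPow x i * divPow y m = ∑ t ∈ Finset.range (i + 1),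
      divPowZ y ((m : ℤ) - t) * binom (h + ((2 * t - m - i : ℤ) : A)) t *
        divPowZ x ((i : ℤ) - t) := by
  induction i with
  | zero => simp [divPow_zero, binom_zero, divPowZ]
  | succ i ih =>
    have hne : ((i : ℂ) + 1) ≠ 0 := by exact_mod_cast Nat.succ_ne_zero i
    refine (smul_right_injective A hne) ?_
    simp only
    rw [← smul_mul_assoc, ← mul_divPow, mul_assoc, ih, Finset.mul_sum]
    let F : ℤ → A := fun t => divPowZ y ((m : ℤ) - t) *
      (((i : ℂ) + 1 - t) • binom (h + ((2 * t - m - i - 2 : ℤ) : A)) t.toNat) * divPowZ x (i + 1 - t)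
    let G : ℤ → A := fun t => divPowZ y ((m : ℤ) - t - 1) * ((h - ((m - t : ℤ) : A) + 1) *
      binom (h + ((2 * t - m - i : ℤ) : A)) t.toNat) * divPowZ x (i - t)
    have hterm : ∀ t : ℕ, x * (divPowZ y ((m : ℤ) - t) * binom (h + ((2 * t - m - i : ℤ) : A)) t *
        divPowZ x ((i : ℤ) - t)) = F t + G t := by
      intro t
      have b := binom_semiconj hx (2 * t - m - i - 2) t
      have s : (2 * t - m - i - 2 + 2 : ℤ) = 2 * t - m - i := by ring
      rw [s] at b
      simp only [F, G]
      rw [← mul_assoc, ← mul_assoc, x_mul_divPow_y hy hxy, add_mul, add_mul, mul_assoc _ x, ← b]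
      simp only [mul_assoc, mul_divPowZ, smul_mul_assoc, mul_smul_comm, Int.toNat_natCast]
      congr 1
      rw [show (i : ℤ) - t + 1 = i + 1 - t by ring]
      congr 1
      push_cast; ring
    rw [Finset.sum_congr rfl (fun t _ => hterm t), Finset.sum_add_distrib]
    have hF : ∑ t ∈ Finset.range (i + 1), F t = ∑ t ∈ Finset.range (i + 1 + 1), F t := by
      rw [Finset.sum_range_succ _ (i + 1)]; simp [F]
    have hG : ∑ t ∈ Finset.range (i + 1), G t
        = ∑ t ∈ Finset.range (i + 1 + 1), if t = 0 then 0 else G ((t : ℤ) - 1) := by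
      rw [Finset.sum_range_succ' _ (i + 1)]; simp
    rw [hF, hG, ← Finset.sum_add_distrib, Finset.smul_sum]
    refine Finset.sum_congr rfl fun t _ => ?_
    cases t with
    | zero => simp [F, binom_zero]
    | succ t =>
      simp only [F, G, Nat.succ_ne_zero, if_false]
      have s1 : (m : ℤ) - (((t + 1 : ℕ) : ℤ) - 1) - 1 = m - ((t + 1 : ℕ) : ℤ) := by ring
      have s2 : (i : ℤ) - (((t + 1 : ℕ) : ℤ) - 1) = ((i + 1 : ℕ) : ℤ) - ((t + 1 : ℕ) : ℤ) := by
        push_cast; ring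
      have s3 : (i : ℤ) + 1 - ((t + 1 : ℕ) : ℤ) = ((i + 1 : ℕ) : ℤ) - ((t + 1 : ℕ) : ℤ) := by
        push_cast; ring
      have s4 : (((t + 1 : ℕ) : ℤ) - 1).toNat = t := by simp
      have s5 : (2 * (((t + 1 : ℕ) : ℤ) - 1) - m - i : ℤ) = 2 * t - m - i := by push_cast; ring
      have s6 : (2 * ((t + 1 : ℕ) : ℤ) - m - i - 2 : ℤ) = 2 * t - m - i := by push_cast; ring
      have s7 : h + ((2 * ((t + 1 : ℕ) : ℤ) - m - ((i + 1 : ℕ) : ℤ) : ℤ) : A)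
          = h + ((2 * t - m - i : ℤ) : A) + 1 := by push_cast; noncomm_ring
      rw [s1, s2, s3, s4, s5, s6, s7, Int.toNat_natCast, binom_add_one, ← add_mul, ← mul_add,
        ← smul_mul_assoc, ← mul_smul_comm]
      congr 2
      have b := succ_smul_binom_succ (h + ((2 * t - m - i : ℤ) : A)) t
      have cm := (commute_binom h (2 * t - m - i) t).eq
      set u := binom (h + ((2 * t - m - i : ℤ) : A)) t
      set v := binom (h + ((2 * t - m - i : ℤ) : A)) (t + 1)
      have e : ((i : ℂ) + 1 - ((((t + 1 : ℕ) : ℤ)) : ℂ)) • v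
          = ((i : ℂ) + 1) • v - ((t : ℂ) + 1) • v := by
        rw [← sub_smul]; push_cast; rfl
      rw [e, b, smul_add, sub_add, sub_eq_add_neg]
      congr 1
      rw [neg_sub, sub_eq_iff_eq_add]
      have d : ∀ z : ℤ, (z : A) * u = u * (z : A) := fun z => (Int.cast_commute z u).eq
      have f : ((i : ℂ) + 1) • u = u * ((i + 1 : ℤ) : A) := by
        rw [← d, ← zsmul_eq_mul, ← Int.cast_smul_eq_zsmul ℂ]; push_cast; rfl
      rw [f, ← mul_add, add_mul, sub_mul, cm, d, one_mul]
      push_cast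
      noncomm_ring

end Commutation

section Integral
variable {A : Type*} [Ring A] [Algebra ℂ A] {x y h : A}

theorem binom_mul_binom_mem (h : A) (c d : ℤ) (t n : ℕ) :
    binom (h + (c : A)) t * binom (h + (d : A)) n ∈ AddSubgroup.closure (Set.range (binom h)) := by
  set L := AddSubgroup.closure (Set.range (binom h))
  have hL : ∀ n, binom h n ∈ L := fun n => AddSubgroup.subset_closure ⟨n, rfl⟩
  have h1 : ∀ t, binom h t * binom (h + (d : A)) n ∈ L := by
    intro t
    have := binom_add_int_mem (L.comap (AddMonoidHom.mulLeft (binom h t))) (h - (t : A)) n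
      (fun i _ => by
        rw [AddSubgroup.mem_comap, AddMonoidHom.coe_mulLeft, binom_mul_binom_sub]
        exact L.zsmul_mem (hL _) _) (d + t) n le_rfl
    rw [AddSubgroup.mem_comap, AddMonoidHom.coe_mulLeft] at this
    convert this using 3
    push_cast; abel
  exact binom_add_int_mem (L.comap (AddMonoidHom.mulRight (binom (h + (d : A)) n))) h t
    (fun i _ => h1 i) c t le_rfl

/-- The product `y^(m) binom(h, n) x^(m')` attached to the triple `(m, n, m')`. -/
def pbw (y h x : A) (i : ℕ × ℕ × ℕ) : A := divPow y i.1 * binom h i.2.1 * divPow x i.2.2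

theorem divPow_mul_pbw_mem (hx : h * x = x * (h + ((2 : ℤ) : A)))
    (hy : h * y = y * (h + ((-2 : ℤ) : A))) (hxy : x * y = y * x + h) (j : ℕ) (i : ℕ × ℕ × ℕ) :
    divPow x j * pbw y h x i ∈ AddSubgroup.closure (Set.range (pbw y h x)) := by
  obtain ⟨m, n, m'⟩ := i
  set S := AddSubgroup.closure (Set.range (pbw y h x))
  have hS : ∀ i, pbw y h x i ∈ S := fun i => AddSubgroup.subset_closure ⟨i, rfl⟩
  have hmid : ∀ (a b : ℕ) (z : A), z ∈ AddSubgroup.closure (Set.range (binom h)) →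
      divPow y a * z * divPow x b ∈ S := by
    intro a b z hz
    have : AddSubgroup.closure (Set.range (binom h)) ≤ S.comap
        ((AddMonoidHom.mulRight (divPow x b)).comp (AddMonoidHom.mulLeft (divPow y a))) := by
      rw [AddSubgroup.closure_le]
      rintro _ ⟨n, rfl⟩
      exact hS (a, n, b)
    exact this hz
  simp only [pbw]
  rw [← mul_assoc, ← mul_assoc, commutation hx hy hxy, Finset.sum_mul, Finset.sum_mul]
  refine S.sum_mem fun t ht => ?_
  have ht : t ≤ j := by simpa [Nat.lt_succ_iff] using ht
  rcases lt_or_ge m t with hm | hm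
  · have : ((m : ℤ) - t) = Int.negSucc (t - m - 1) := by omega
    rw [this]
    simp [divPowZ]
  · rw [← Nat.cast_sub hm, ← Nat.cast_sub ht, divPowZ_natCast, divPowZ_natCast]
    have hc := semiconj_divPow hx (j - t)
    have hb := binom_semiconj hc (-(((j - t : ℕ) : ℤ) * 2)) n
    rw [neg_add_cancel, Int.cast_zero, add_zero] at hb
    rw [mul_assoc _ _ (binom h n), ← hb, mul_assoc, mul_assoc, mul_assoc, divPow_mul_divPow,
      mul_smul_comm, mul_smul_comm, mul_smul_comm, ← mul_assoc, ← mul_assoc, mul_assoc (divPow y _)]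
    exact S.zsmul_mem (hmid _ _ _ (binom_mul_binom_mem h _ _ _ _)) _

theorem divPow_mul_pbw_mem' (j : ℕ) (i : ℕ × ℕ × ℕ) :
    divPow y j * pbw y h x i ∈ AddSubgroup.closure (Set.range (pbw y h x)) := by
  obtain ⟨m, n, m'⟩ := i
  simp only [pbw]
  rw [← mul_assoc, ← mul_assoc, divPow_mul_divPow, smul_mul_assoc, smul_mul_assoc]
  have hmem : pbw y h x (j + m, n, m') ∈ AddSubgroup.closure (Set.range (pbw y h x)) :=
    AddSubgroup.subset_closure ⟨_, rfl⟩
  exact AddSubgroup.zsmul_mem _ hmem _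

theorem binom_mem_closure (hx : h * x = x * (h + ((2 : ℤ) : A)))
    (hy : h * y = y * (h + ((-2 : ℤ) : A))) (hxy : x * y = y * x + h) (c : ℤ) (n : ℕ) :
    binom (h + (c : A)) n ∈ Subring.closure (Set.range (divPow x) ∪ Set.range (divPow y)) := by
  set U := Subring.closure (Set.range (divPow x) ∪ Set.range (divPow y))
  have hX : ∀ m, divPow x m ∈ U := fun m => Subring.subset_closure (Or.inl ⟨m, rfl⟩)
  have hY : ∀ m, divPow y m ∈ U := fun m => Subring.subset_closure (Or.inr ⟨m, rfl⟩)
  have hXZ : ∀ m, divPowZ x m ∈ U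
    | (m : ℕ) => hX m
    | Int.negSucc _ => U.zero_mem
  have hYZ : ∀ m, divPowZ y m ∈ U
    | (m : ℕ) => hY m
    | Int.negSucc _ => U.zero_mem
  have key : ∀ n, binom h n ∈ U := by
    intro n
    induction n using Nat.strong_induction_on with
    | _ n ih =>
      have := commutation hx hy hxy n n
      rw [Finset.sum_range_succ] at this
      simp only [sub_self] at this
      rw [show (2 * n - n - n : ℤ) = 0 by ring, Int.cast_zero, add_zero,
        show divPowZ y 0 = 1 from divPow_zero y, show divPowZ x 0 = 1 from divPow_zero x,
        one_mul, mul_one] at this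
      rw [← sub_eq_of_eq_add' this]
      refine U.sub_mem (U.mul_mem (hX n) (hY n)) (U.sum_mem fun t ht => ?_)
      refine U.mul_mem (U.mul_mem (hYZ _) ?_) (hXZ _)
      have ht : t < n := by simpa using ht
      exact binom_add_int_mem U.toAddSubgroup h t (fun i hi => ih i (by omega)) _ t le_rfl
  exact binom_add_int_mem U.toAddSubgroup h n (fun i _ => key i) c n le_rfl

theorem closure_eq_span (hx : h * x = x * (h + ((2 : ℤ) : A)))
    (hy : h * y = y * (h + ((-2 : ℤ) : A))) (hxy : x * y = y * x + h) {z : A}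
    (hz : z ∈ Subring.closure (Set.range (divPow x) ∪ Set.range (divPow y))) :
    z ∈ AddSubgroup.closure (Set.range (pbw y h x)) := by
  set S := AddSubgroup.closure (Set.range (pbw y h x))
  have hone : (1 : A) ∈ S :=
    AddSubgroup.subset_closure ⟨(0, 0, 0), by simp [pbw, divPow_zero, binom_zero]⟩
  have lift : ∀ a : A, (∀ i, a * pbw y h x i ∈ S) → ∀ s ∈ S, a * s ∈ S := by
    intro a ha s hs
    have : S ≤ S.comap (AddMonoidHom.mulLeft a) := by
      rw [AddSubgroup.closure_le]
      rintro _ ⟨i, rfl⟩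
      exact ha i
    exact this hs
  have key : ∀ s ∈ S, z * s ∈ S := by
    induction hz using Subring.closure_induction with
    | mem a ha =>
      rcases ha with ⟨m, rfl⟩ | ⟨m, rfl⟩
      · exact lift _ (divPow_mul_pbw_mem hx hy hxy m)
      · exact lift _ (divPow_mul_pbw_mem' m)
    | zero => intro s _; simp [S.zero_mem]
    | one => intro s hs; simpa using hs
    | add a b _ _ ha hb => intro s hs; rw [add_mul]; exact S.add_mem (ha s hs) (hb s hs)
    | neg a _ ha => intro s hs; rw [neg_mul]; exact S.neg_mem (ha s hs)
    | mul a b _ _ ha hb => intro s hs; rw [mul_assoc]; exact ha _ (hb s hs)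
  simpa using key 1 hone

end Integral

section Enveloping

attribute [local instance] LieRing.ofAssociativeRing LieAlgebra.ofAssociativeAlgebra

/-- The universal enveloping algebra of `sl₂(ℂ)`. -/
abbrev UC : Type := UniversalEnvelopingAlgebra ℂ (LieAlgebra.SpecialLinear.sl (Fin 2) ℂ)

/-- The matrix `X = (0 1; 0 0)`. -/
def matX : LieAlgebra.SpecialLinear.sl (Fin 2) ℂ :=
  ⟨!![0, 1; 0, 0], by simp [LieAlgebra.SpecialLinear.sl]⟩

/-- The matrix `Y = (0 0; 1 0)`. -/
def matY : LieAlgebra.SpecialLinear.sl (Fin 2) ℂ :=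
  ⟨!![0, 0; 1, 0], by simp [LieAlgebra.SpecialLinear.sl]⟩

/-- The matrix `H = (1 0; 0 -1)`. -/
def matH : LieAlgebra.SpecialLinear.sl (Fin 2) ℂ :=
  ⟨!![1, 0; 0, -1], by simp [LieAlgebra.SpecialLinear.sl]⟩

def eX : UC := UniversalEnvelopingAlgebra.ι ℂ matX
def eY : UC := UniversalEnvelopingAlgebra.ι ℂ matY
def eH : UC := UniversalEnvelopingAlgebra.ι ℂ matH

theorem lie_HX : ⁅matH, matX⁆ = (2 : ℂ) • matX := by
  apply Subtype.ext
  ext i j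
  fin_cases i <;> fin_cases j <;>
    simp [matH, matX, LieRing.of_associative_ring_bracket]
  norm_num

theorem lie_HY : ⁅matH, matY⁆ = (-2 : ℂ) • matY := by
  apply Subtype.ext
  ext i j
  fin_cases i <;> fin_cases j <;>
    simp [matH, matY, LieRing.of_associative_ring_bracket]
  norm_num

theorem lie_XY : ⁅matX, matY⁆ = matH := by
  apply Subtype.ext
  ext i j
  fin_cases i <;> fin_cases j <;>
    simp [matH, matX, matY, LieRing.of_associative_ring_bracket]

theorem eH_mul_eX : eH * eX = eX * (eH + ((2 : ℤ) : UC)) := by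
  have := congrArg (UniversalEnvelopingAlgebra.ι ℂ) lie_HX
  rw [LieHom.map_lie, LieRing.of_associative_ring_bracket, map_smul] at this
  change eH * eX - eX * eH = (2 : ℂ) • eX at this
  rw [sub_eq_iff_eq_add] at this
  rw [this, mul_add, add_comm, two_smul]; push_cast; noncomm_ring

theorem eH_mul_eY : eH * eY = eY * (eH + ((-2 : ℤ) : UC)) := by
  have := congrArg (UniversalEnvelopingAlgebra.ι ℂ) lie_HY
  rw [LieHom.map_lie, LieRing.of_associative_ring_bracket, map_smul] at this
  change eH * eY - eY * eH = (-2 : ℂ) • eY at this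
  rw [sub_eq_iff_eq_add] at this
  rw [this, mul_add, add_comm, neg_smul, two_smul]; push_cast; noncomm_ring

theorem eX_mul_eY : eX * eY = eY * eX + eH := by
  have := congrArg (UniversalEnvelopingAlgebra.ι ℂ) lie_XY
  rw [LieHom.map_lie, LieRing.of_associative_ring_bracket] at this
  change eX * eY - eY * eX = eH at this
  rw [sub_eq_iff_eq_add] at this
  rw [this, add_comm]

/-- Raising operator of the generic Verma module (auxiliary). -/
def opX : Module.End ℂ (ℕ → ℂ[X]) where
  toFun f i := ((i : ℂ[X]) + 1) * (X - (i : ℂ[X])) * f (i + 1)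
  map_add' f g := by funext i; simp [mul_add]
  map_smul' c f := by funext i; simp

/-- Lowering operator of the generic Verma module (auxiliary). -/
def opY : Module.End ℂ (ℕ → ℂ[X]) where
  toFun f i := match i with
    | 0 => 0
    | i + 1 => f i
  map_add' f g := by funext i; cases i <;> simp
  map_smul' c f := by funext i; cases i <;> simp

/-- Weight operator of the generic Verma module (auxiliary). -/
def opH : Module.End ℂ (ℕ → ℂ[X]) where
  toFun f i := (X - 2 * (i : ℂ[X])) * f i
  map_add' f g := by funext i; simp [mul_add]
  map_smul' c f := by funext i; simp

/-- The generic Verma module as a representation (auxiliary). -/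
def verma : LieAlgebra.SpecialLinear.sl (Fin 2) ℂ →ₗ⁅ℂ⁆ Module.End ℂ (ℕ → ℂ[X]) where
  toFun a := a.1 0 0 • opH + a.1 0 1 • opX + a.1 1 0 • opY
  map_add' a b := by simp [add_smul]; abel
  map_smul' c a := by simp [mul_smul]
  map_lie' := by
    intro a b
    have ha : a.1 1 1 = - a.1 0 0 := by
      have := a.2
      simp [LieAlgebra.SpecialLinear.sl, Matrix.trace, Fin.sum_univ_two] at this
      linear_combination this
    have hb : b.1 1 1 = - b.1 0 0 := by
      have := b.2
      simp [LieAlgebra.SpecialLinear.sl, Matrix.trace, Fin.sum_univ_two] at this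
      linear_combination this
    refine LinearMap.ext fun f => funext fun i => ?_
    simp only [LieAlgebra.SpecialLinear.sl_bracket, Matrix.sub_apply, Matrix.mul_apply,
      Fin.sum_univ_two, ha, hb, LieRing.of_associative_ring_bracket, LinearMap.sub_apply,
      LinearMap.add_apply, LinearMap.smul_apply, Module.End.mul_apply, Pi.sub_apply, Pi.add_apply,
      Pi.smul_apply, map_add, map_smul, Polynomial.smul_eq_C_mul]
    rcases i with _ | _ | i <;> simp [opX, opY, opH] <;> ring

theorem verma_eX : UniversalEnvelopingAlgebra.lift ℂ verma eX = opX := by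
  rw [eX, UniversalEnvelopingAlgebra.lift_ι_apply]; simp [verma, matX]

theorem verma_eY : UniversalEnvelopingAlgebra.lift ℂ verma eY = opY := by
  rw [eY, UniversalEnvelopingAlgebra.lift_ι_apply]; simp [verma, matY]

theorem verma_eH : UniversalEnvelopingAlgebra.lift ℂ verma eH = opH := by
  rw [eH, UniversalEnvelopingAlgebra.lift_ι_apply]; simp [verma, matH]

theorem opX_single_zero (g : ℂ[X]) : opX (Pi.single 0 g) = 0 := by
  funext i; simp [opX]

theorem opX_single_succ (d : ℕ) (g : ℂ[X]) :
    opX (Pi.single (d + 1) g) = Pi.single d (((d : ℂ[X]) + 1) * (X - (d : ℂ[X])) * g) := by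
  funext i
  rcases eq_or_ne i d with rfl | hi
  · simp [opX]
  · simp [opX, Pi.single_eq_of_ne hi, Pi.single_eq_of_ne (show i + 1 ≠ d + 1 by omega)]

theorem opY_single (d : ℕ) (g : ℂ[X]) : opY (Pi.single d g) = Pi.single (d + 1) g := by
  funext i
  cases i with
  | zero => simp [opY]
  | succ i =>
    rcases eq_or_ne i d with rfl | hi
    · simp [opY]
    · simp [opY, Pi.single_eq_of_ne hi, Pi.single_eq_of_ne (show i + 1 ≠ d + 1 by omega)]

theorem opY_pow_single (m : ℕ) (g : ℂ[X]) : (opY ^ m) (Pi.single 0 g) = Pi.single m g := by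
  induction m with
  | zero => simp
  | succ m ih => rw [pow_succ', Module.End.mul_apply, ih, opY_single]

theorem opX_pow_single (d : ℕ) : ∀ g : ℂ[X], g ≠ 0 →
    ∃ q : ℂ[X], q ≠ 0 ∧ (opX ^ d) (Pi.single d g) = Pi.single 0 q := by
  induction d with
  | zero => intro g hg; exact ⟨g, hg, by simp⟩
  | succ d ih =>
    intro g hg
    rw [pow_succ]
    have h1 : (d : ℂ[X]) + 1 ≠ 0 := by exact_mod_cast Nat.succ_ne_zero d
    have h2 : (X : ℂ[X]) - (d : ℂ[X]) ≠ 0 := by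
      rw [← C_eq_natCast]; exact X_sub_C_ne_zero _
    obtain ⟨q, hq, e⟩ := ih _ (mul_ne_zero (mul_ne_zero h1 h2) hg)
    exact ⟨q, hq, by rw [Module.End.mul_apply, opX_single_succ, e]⟩

theorem opX_pow_single_of_lt {d j : ℕ} (hj : d < j) {g : ℂ[X]} (hg : g ≠ 0) :
    (opX ^ j) (Pi.single d g) = 0 := by
  obtain ⟨q, -, e⟩ := opX_pow_single d g hg
  obtain ⟨k, rfl⟩ : ∃ k, j = k + 1 + d := ⟨j - d - 1, by omega⟩
  rw [pow_add, Module.End.mul_apply, e, pow_succ, Module.End.mul_apply, opX_single_zero, map_zero]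

theorem aeval_opH_single (P g : ℂ[X]) :
    (aeval opH P) (Pi.single 0 g) = Pi.single 0 (P * g) := by
  have h : ∀ g : ℂ[X], opH (Pi.single 0 g) = Pi.single 0 (X * g) := by
    intro g; funext i
    rcases eq_or_ne i 0 with rfl | hi
    · simp [opH]
    · simp [opH, Pi.single_eq_of_ne hi]
  induction P using Polynomial.induction_on' generalizing g with
  | add p q hp hq => rw [map_add, LinearMap.add_apply, hp, hq, add_mul, Pi.single_add]
  | monomial n a =>
    rw [aeval_monomial, Module.End.mul_apply, Module.algebraMap_end_apply]
    have : (opH ^ n) (Pi.single 0 g) = Pi.single 0 (X ^ n * g) := by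
      induction n with
      | zero => simp
      | succ n ih => rw [pow_succ', Module.End.mul_apply, ih, h, pow_succ', mul_assoc]
    rw [this, ← Pi.single_smul, ← C_mul_X_pow_eq_monomial, Polynomial.smul_eq_C_mul, mul_assoc]

theorem linearIndependent_pbw_complex : LinearIndependent ℂ (pbw eY eH eX) := by
  rw [linearIndependent_iff]
  intro l hl
  by_contra hne
  obtain ⟨⟨m, n₀, d⟩, hi₀, hmin⟩ :=
    l.support.exists_min_image (fun i => i.2.2) (Finsupp.support_nonempty_iff.2 hne)
  obtain ⟨⟨m₁, n, d₁⟩, hi, hmax⟩ :=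
    (l.support.filter (fun i => i.1 = m ∧ i.2.2 = d)).exists_max_image (fun i => i.2.1)
      ⟨(m, n₀, d), by simpa using hi₀⟩
  clear hi₀
  rw [Finset.mem_filter] at hi
  obtain ⟨hi, rfl, rfl⟩ := hi
  simp only at hmin hmax hi
  obtain ⟨q, hq, e⟩ := opX_pow_single d₁ 1 one_ne_zero
  have h0 := congrArg (fun u => UniversalEnvelopingAlgebra.lift ℂ verma u
    (Pi.single d₁ (1 : ℂ[X])) m₁) hl
  have val : ∀ (m' n' d' : ℕ), d₁ ≤ d' →
      UniversalEnvelopingAlgebra.lift ℂ verma (pbw eY eH eX (m', n', d'))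
        (Pi.single d₁ (1 : ℂ[X])) m₁ = if m' = m₁ ∧ d' = d₁ then
          (((m₁ ! : ℂ)⁻¹ * (n' ! : ℂ)⁻¹ * (d₁ ! : ℂ)⁻¹) • (descPochhammer ℂ n' * q)) else 0 := by
    intro m' n' d' hd
    simp only [pbw, divPow, binom, map_mul, map_smul, map_pow, ← Polynomial.aeval_algHom_apply,
      verma_eX, verma_eY, verma_eH, Module.End.mul_apply, LinearMap.smul_apply]
    rcases hd.eq_or_lt with rfl | hd
    · rw [e, aeval_opH_single, opY_pow_single]
      by_cases hm : m' = m₁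
      · subst hm
        simp only [Pi.smul_apply, Pi.single_eq_same, smul_smul, and_self, if_true]
        congr 1; ring
      · simp [hm]
    · rw [opX_pow_single_of_lt hd one_ne_zero]
      simp [hd.ne']
  rw [Finsupp.linearCombination_apply, Finsupp.sum] at h0
  simp only [map_sum, map_smul, LinearMap.sum_apply, LinearMap.smul_apply, Finset.sum_apply,
    Pi.smul_apply, map_zero, LinearMap.zero_apply, Pi.zero_apply] at h0
  have h1 : (∑ i ∈ l.support, if i.1 = m₁ ∧ i.2.2 = d₁ then
      (l i * ((m₁ ! : ℂ)⁻¹ * (i.2.1 ! : ℂ)⁻¹ * (d₁ ! : ℂ)⁻¹)) • descPochhammer ℂ i.2.1 else 0)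
        * q = 0 := by
    refine Eq.trans ?_ h0
    rw [Finset.sum_mul]
    refine Finset.sum_congr rfl fun i hi' => ?_
    obtain ⟨m', n', d'⟩ := i
    rw [val m' n' d' (hmin _ hi')]
    split_ifs with hc
    · rw [smul_smul, smul_mul_assoc]
    · simp only [smul_zero, zero_mul]
  have h2 := congrArg (fun P => P.coeff n) ((mul_eq_zero.1 h1).resolve_right hq)
  simp only [finsetSum_coeff, coeff_zero] at h2
  rw [Finset.sum_eq_single (m₁, n, d₁)] at h2
  · have hc : (descPochhammer ℂ n).coeff n = 1 := by
      have := monic_descPochhammer ℂ n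
      rwa [Monic, leadingCoeff, descPochhammer_natDegree] at this
    simp only [and_self, if_true, coeff_smul, hc, smul_eq_mul, mul_one] at h2
    have f1 : ((m₁ ! : ℕ) : ℂ) ≠ 0 := by exact_mod_cast m₁.factorial_ne_zero
    have f2 : ((n ! : ℕ) : ℂ) ≠ 0 := by exact_mod_cast n.factorial_ne_zero
    have f3 : ((d₁ ! : ℕ) : ℂ) ≠ 0 := by exact_mod_cast d₁.factorial_ne_zero
    have : l (m₁, n, d₁) ≠ 0 := by simpa using hi
    simp [f1, f2, f3, this] at h2
  · rintro ⟨m', n', d'⟩ hi' hne'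
    by_cases hc : m' = m₁ ∧ d' = d₁
    · obtain ⟨rfl, rfl⟩ := hc
      have hle := hmax (m', n', d') (by simpa using hi')
      have hlt : n' < n := lt_of_le_of_ne hle (fun h => hne' (by rw [h]))
      simp only [and_self, if_true, coeff_smul]
      rw [coeff_eq_zero_of_natDegree_lt (by rwa [descPochhammer_natDegree]), smul_zero]
    · rw [if_neg hc]; simp
  · intro h; exact absurd hi h

end Enveloping
section IntegralForm

/-- The integral form `U_ℤ`: the subring of the enveloping algebra of `sl₂(ℂ)` generated by the
divided powers `X^(m)`, `Y^(m)`. -/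
def UZ : Subring UC := Subring.closure (Set.range (divPow eX) ∪ Set.range (divPow eY))

theorem divPow_eX_mem (m : ℕ) : divPow eX m ∈ UZ := Subring.subset_closure (Or.inl ⟨m, rfl⟩)

theorem divPow_eY_mem (m : ℕ) : divPow eY m ∈ UZ := Subring.subset_closure (Or.inr ⟨m, rfl⟩)

theorem eX_mem : eX ∈ UZ := by simpa [divPow_one] using divPow_eX_mem 1

theorem eY_mem : eY ∈ UZ := by simpa [divPow_one] using divPow_eY_mem 1

theorem binom_eH_mem (c : ℤ) (n : ℕ) : binom (eH + (c : UC)) n ∈ UZ :=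
  binom_mem_closure eH_mul_eX eH_mul_eY eX_mul_eY c n

theorem pbw_mem (i : ℕ × ℕ × ℕ) : pbw eY eH eX i ∈ UZ :=
  UZ.mul_mem (UZ.mul_mem (divPow_eY_mem _) (by simpa using binom_eH_mem 0 i.2.1))
    (divPow_eX_mem _)

/-- The elements `Y^(m) binom(H, n) X^(m')` of `U_ℤ`. -/
def pbwZ (i : ℕ × ℕ × ℕ) : UZ := ⟨pbw eY eH eX i, pbw_mem i⟩

theorem linearIndependent_pbwZ : LinearIndependent ℤ pbwZ := by
  have h : LinearIndependent ℤ (pbw eY eH eX) :=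
    linearIndependent_pbw_complex.restrict_scalars
      (by intro a b hab; simpa using hab)
  exact LinearIndependent.of_comp UZ.subtype.toIntAlgHom.toLinearMap h

theorem span_pbwZ : ⊤ ≤ Submodule.span ℤ (Set.range pbwZ) := by
  rintro ⟨z, hz⟩ -
  have h := closure_eq_span eH_mul_eX eH_mul_eY eX_mul_eY hz
  have h2 : AddSubgroup.closure (Set.range (pbw eY eH eX)) ≤
      ((Submodule.span ℤ (Set.range pbwZ)).map UZ.subtype.toIntAlgHom.toLinearMap).toAddSubgroup := by
    rw [AddSubgroup.closure_le]
    rintro _ ⟨i, rfl⟩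
    exact ⟨pbwZ i, Submodule.subset_span ⟨i, rfl⟩, rfl⟩
  obtain ⟨w, hw, e⟩ := h2 h
  have : w = ⟨z, hz⟩ := Subtype.ext e
  exact this ▸ hw

/-- The `ℤ`-basis `Y^(m) binom(H, n) X^(m')` of `U_ℤ`, indexed by `(m, n, m')`. -/
def basisZ : Module.Basis (ℕ × ℕ × ℕ) ℤ UZ := Module.Basis.mk linearIndependent_pbwZ span_pbwZ

end IntegralForm

section Hyperalgebra
variable (k : Type*) [Field k]

/-- The hyperalgebra `𝒰 = Dist(SL₂)` over `k`, i.e. the scalar extension of `U_ℤ` to `k`. -/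
abbrev Hyperalgebra : Type _ := k ⊗[ℤ] UZ

/-- The image of `X` in `𝒰`. -/
def genX : Hyperalgebra k := 1 ⊗ₜ ⟨eX, eX_mem⟩

/-- The image of `Y` in `𝒰`. -/
def genY : Hyperalgebra k := 1 ⊗ₜ ⟨eY, eY_mem⟩

/-- The image of `binom(H + c, n)` in `𝒰`, for an integer `c`. -/
def binomH (c : ℤ) (n : ℕ) : Hyperalgebra k := 1 ⊗ₜ ⟨binom (eH + (c : UC)) n, binom_eH_mem c n⟩

/-- The `k`-basis `Y^(m) binom(H, n) X^(m')` of `𝒰`, indexed by `(m, n, m')`. -/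
def basis : Module.Basis (ℕ × ℕ × ℕ) k (Hyperalgebra k) := Algebra.TensorProduct.basis k basisZ

/-- The basis vector at `(m, n, m')` is the image of `Y^(m) binom(H, n) X^(m')`. -/
theorem basis_apply (i : ℕ × ℕ × ℕ) : basis k i = 1 ⊗ₜ pbwZ i := by
  simp [basis, basisZ]

/-- The `k`-linear map `FrPrime` (that is, Fr-prime) sending `Y^(m) binom(H, n) X^(m')` to
`Y^(mp) binom(H, np) X^(m'p)`. -/
def FrPrime (p : ℕ) : Hyperalgebra k →ₗ[k] Hyperalgebra k :=
  (basis k).constr k fun i => basis k (i.1 * p, i.2.1 * p, i.2.2 * p)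

/-- `μ_a = binom(H - a - 1, p - 1)`. -/
def mu (p : ℕ) (a : ℤ) : Hyperalgebra k := binomH k (-a - 1) (p - 1)

end Hyperalgebra

section Elements
variable (p : ℕ) [Fact p.Prime]

/-- The set `𝒫` of pairs `(a, j)`. For odd `p` it is `{0, …, p - 1} × {0, …, (p - 1) / 2}`; for
`p = 2` it is `{(0, 1/2), (1, 0), (1, 1)}`. -/
def paramSet : Set (ℤ × ℚ) :=
  if p = 2 then {(0, 1 / 2), (1, 0), (1, 1)}
  else {q | 0 ≤ q.1 ∧ q.1 ≤ (p : ℤ) - 1 ∧ ∃ i : ℕ, i ≤ (p - 1) / 2 ∧ q.2 = (i : ℚ)}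

/-- `φ_{a,m}(x) = ∏_{i < m} (x - i (i + a + 1))`. -/
def phi (a : ℤ) (m : ℕ) : (ZMod p)[X] :=
  ∏ i ∈ Finset.range m, (X - C ((i : ZMod p) * ((i : ZMod p) + (a : ZMod p) + 1)))

/-- `ψ(x) = ∏_{i ∈ 𝔽_p} (x - i²)`. -/
def psi : (ZMod p)[X] := ∏ i : ZMod p, (X - C (i ^ 2))

/-- The polynomials `ψ_j^{(ε)}` for odd `p`, with `j` given by its image in `𝔽_p`:
`ψ_j^{(1)} = ψ / (x - j²)`, `ψ_0^{(0)} = ∏_{i ≠ 0} (x - i²)` and, for `j ≠ 0`,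
`ψ_j^{(0)} = 2 x (x + j²) ∏_{i ≠ 0, j, -j} (x - i²)`. -/
def psiE (ε : Fin 2) (j : ZMod p) : (ZMod p)[X] :=
  if ε = 1 then psi p /ₘ (X - C (j ^ 2))
  else if j = 0 then ∏ i ∈ Finset.univ.filter (fun i : ZMod p => i ≠ 0), (X - C (i ^ 2))
  else 2 * X * (X + C (j ^ 2)) *
    ∏ i ∈ Finset.univ.filter (fun i : ZMod p => i ≠ 0 ∧ i ≠ j ∧ i ≠ -j), (X - C (i ^ 2))

/-- The element `((a + 1) / 2)²` of `𝔽_p` (for odd `p`). -/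
def shift (a : ℤ) : ZMod p := (((a : ZMod p) + 1) / 2) ^ 2

/-- `n^{(ε)}(a, j)`: for odd `p` the largest `n` such that `φ_{a,n}(x)` divides
`ψ_j^{(ε)}(x + ((a + 1) / 2)²)`; for `p = 2` it is `1` at `(1, 0)`, `0` at `(1, 1)` and `ε` at
`(0, 1/2)`. -/
def nNum (ε : Fin 2) (a : ℤ) (j : ℚ) : ℕ :=
  if p = 2 then (if a = 1 then (if j = 0 then 1 else 0) else (ε : ℕ))
  else sSup {n : ℕ | phi p a n ∣ (psiE p ε (j.num : ZMod p)).comp (X + C (shift p a))}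

/-- Condition (A): `a` is even and `(p - a + 1) / 2 ≤ j ≤ (p - 1) / 2`. -/
def CondA (a : ℤ) (j : ℚ) : Prop :=
  Even a ∧ ((p : ℚ) - a + 1) / 2 ≤ j ∧ j ≤ ((p : ℚ) - 1) / 2

/-- Condition (C): `a` is odd and `0 ≤ j ≤ (a - 1) / 2`. -/
def CondC (a : ℤ) (j : ℚ) : Prop :=
  Odd a ∧ 0 ≤ j ∧ j ≤ ((a : ℚ) - 1) / 2

/-- The integer `s(a, j)`, used under (A) or (C): `(p - a + 1) / 2` for `p` odd and `a` even,
`(p - a) / 2` for `p` and `a` odd, and `1` for `p = 2`. -/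
def sNum (a : ℤ) : ℕ :=
  if p = 2 then 1
  else if Even a then (((p : ℤ) - a + 1) / 2).toNat else (((p : ℤ) - a) / 2).toNat

variable (k : Type*) [Field k] [CharP k p]

/-- The embedding of `𝔽_p` into `k`. -/
def emb : ZMod p →+* k := ZMod.castHom (dvd_refl p) k

/-- The element `B^{(ε)}(a, j)` of `𝒰` for a pair `(a, j)` in `𝒫`. For odd `p` it is
`ψ_j^{(ε)}(μ_a Y X + ((a + 1) / 2)²) μ_a`. For `p = 2` it is `μ_0` or `μ_0 Y X` at `(0, 1/2)`
(for `ε = 0` or `ε = 1`), `μ_1 Y X` at `(1, 0)` and `μ_1 Y X + μ_1` at `(1, 1)`. -/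
def B1 (ε : Fin 2) (a : ℤ) (j : ℚ) : Hyperalgebra k :=
  if p = 2 then
    if a = 0 then (if ε = 0 then mu k p 0 else mu k p 0 * genY k * genX k)
    else if j = 0 then mu k p 1 * genY k * genX k
    else mu k p 1 * genY k * genX k + mu k p 1
  else
    aeval (mu k p a * genY k * genX k + algebraMap k (Hyperalgebra k) (emb p k (shift p a)))
      ((psiE p ε (j.num : ZMod p)).map (emb p k)) * mu k p a

/-- The coefficients `c_m ∈ 𝔽_p` in the (unique) expansion
`B^{(ε)}(a, j) = μ_a ∑_{m = n^{(ε)}(a, j)}^{p - 1} c_m Y^m X^m`. -/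
def coeffs (ε : Fin 2) (a : ℤ) (j : ℚ) : ℕ → ZMod p :=
  Classical.epsilon fun c => B1 p k ε a j =
    mu k p a * ∑ m ∈ Finset.Icc (nNum p ε a j) (p - 1), emb p k (c m) • (genY k ^ m * genX k ^ m)

open scoped Classical in
/-- The map `z ↦ Z^{(ε)}(z; (a, j))`, given by
`μ_a ∑_m c_m Y^m X^{m - s(a, j)} Fr'(z) X^{s(a, j)}` if `(a, j)` satisfies (A) or (C), and by
`Fr'(z) B^{(ε)}(a, j)` for the remaining pairs of `𝒫`. In the first case every `m` in the sum
satisfies `m ≥ s(a, j)`. For `p = 2` only `(1, 0)` falls under the first case. -/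
def Z (ε : Fin 2) (a : ℤ) (j : ℚ) (z : Hyperalgebra k) : Hyperalgebra k :=
  if CondA p a j ∨ CondC a j then
    mu k p a * ∑ m ∈ Finset.Icc (nNum p ε a j) (p - 1), emb p k (coeffs p k ε a j m) •
      (genY k ^ m * genX k ^ (m - sNum p a) * FrPrime k p z * genX k ^ sNum p a)
  else FrPrime k p z * B1 p k ε a j

/-- The element `B^{(ε_0, …, ε_{r-1})}((a_0, …, a_{r-1}), (j_0, …, j_{r-1}))` of `𝒰`, for `r ≥ 1`
(the value at `r = 0` is irrelevant). -/
def B : (r : ℕ) → (Fin r → Fin 2) → (Fin r → ℤ) → (Fin r → ℚ) → Hyperalgebra k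
  | 0, _, _, _ => 1
  | 1, ε, a, j => B1 p k (ε 0) (a 0) (j 0)
  | r + 2, ε, a, j =>
    Z p k (ε 0) (a 0) (j 0) (B (r + 1) (Fin.tail ε) (Fin.tail a) (Fin.tail j))

end Elements
end SL2Hyper
end

/-! When `p` is odd, `ψ_0^{(0)} = ∏_{i ≠ 0} (x - i²) = ψ / x = ψ_0^{(1)}`; when `p = 2`, neither
`B^{(ε)}(1, j)` nor `n^{(ε)}(1, j)` mentions `ε`. So in the exceptional cases `B^{(ε)}(a, j)` and
`n^{(ε)}(a, j)` do not depend on `ε`. These two determine the coefficients `c_m`, hence the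
map `z ↦ Z^{(ε)}(z; (a, j))`, and the general case follows by induction on `r`. -/

namespace SL2Hyper
open Polynomial

theorem prod_X_sub_C_divByMonic {ι R : Type*} [DecidableEq ι] [CommRing R] (s : Finset ι)
    (f : ι → R) {i : ι} (hi : i ∈ s) :
    (∏ l ∈ s, (X - C (f l))) /ₘ (X - C (f i)) = ∏ l ∈ s.erase i, (X - C (f l)) := by
  rw [← Finset.mul_prod_erase s _ hi, mul_divByMonic_cancel_left _ (monic_X_sub_C _)]

section
variable {p : ℕ} [Fact p.Prime]

theorem psi_divByMonic (i : ZMod p) :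
    psi p /ₘ (X - C (i ^ 2)) = ∏ l ∈ Finset.univ.filter (· ≠ i), (X - C (l ^ 2)) := by
  rw [psi, prod_X_sub_C_divByMonic _ (· ^ 2) (Finset.mem_univ i), Finset.filter_ne']

theorem psiE_zero (ε : Fin 2) :
    psiE p ε 0 = ∏ i ∈ Finset.univ.filter (fun i : ZMod p => i ≠ 0), (X - C (i ^ 2)) := by
  rw [psiE, psi_divByMonic, if_pos rfl, ite_self]

end

/-- The condition on `(a, j)` under which `B^{(ε)}(a, j)` does not depend on `ε`: `a = 1` if
`p = 2`, and `j = 0` otherwise. It is stated for all `a` and `j`, not only for pairs in `𝒫`. -/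
def EpsilonFree (p : ℕ) (a : ℤ) (j : ℚ) : Prop := if p = 2 then a = 1 else j = 0

section
variable {p : ℕ} [Fact p.Prime] {a : ℤ} {j : ℚ}

theorem epsilonFree_iff : EpsilonFree p a j ↔ ¬((Odd p ∧ j ≠ 0) ∨ (p = 2 ∧ a ≠ 1)) := by
  by_cases hp : p = 2
  · simp [EpsilonFree, hp]
  · simp [EpsilonFree, hp, (Fact.out : p.Prime).odd_of_ne_two hp]

theorem EpsilonFree.nNum_eq (h : EpsilonFree p a j) (ε δ : Fin 2) :
    nNum p ε a j = nNum p δ a j := by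
  by_cases hp : p = 2
  · have ha : a = 1 := by simpa [EpsilonFree, hp] using h
    simp [nNum, hp, ha]
  · have hj : j = 0 := by simpa [EpsilonFree, hp] using h
    simp [nNum, hp, hj, psiE_zero]

theorem EpsilonFree.B1_eq (k : Type*) [Field k] [CharP k p] (h : EpsilonFree p a j)
    (ε δ : Fin 2) : B1 p k ε a j = B1 p k δ a j := by
  by_cases hp : p = 2
  · have ha : a = 1 := by simpa [EpsilonFree, hp] using h
    simp [B1, hp, ha]
  · have hj : j = 0 := by simpa [EpsilonFree, hp] using h
    simp [B1, hp, hj, psiE_zero]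

end

section
variable {p : ℕ} [Fact p.Prime] {k : Type*} [Field k] [CharP k p]

theorem coeffs_congr {ε δ : Fin 2} {a : ℤ} {j : ℚ} (hn : nNum p ε a j = nNum p δ a j)
    (hB : B1 p k ε a j = B1 p k δ a j) : coeffs p k ε a j = coeffs p k δ a j := by
  rw [coeffs, coeffs, hn, hB]

theorem Z_congr {ε δ : Fin 2} {a : ℤ} {j : ℚ} (hn : nNum p ε a j = nNum p δ a j)
    (hB : B1 p k ε a j = B1 p k δ a j) : Z p k ε a j = Z p k δ a j := by
  funext z
  rw [Z, Z, hn, hB, coeffs_congr hn hB]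

theorem B_congr {r : ℕ} {ε δ : Fin r → Fin 2} {a : Fin r → ℤ} {j : Fin r → ℚ}
    (hn : ∀ s, nNum p (ε s) (a s) (j s) = nNum p (δ s) (a s) (j s))
    (hB : ∀ s, B1 p k (ε s) (a s) (j s) = B1 p k (δ s) (a s) (j s)) :
    B p k r ε a j = B p k r δ a j := by
  induction r with
  | zero => rfl
  | succ r ih =>
    cases r with
    | zero => exact hB 0
    | succ r =>
      rw [B, B, Z_congr (hn 0) (hB 0)]
      exact congrArg _ (ih (fun s => hn s.succ) fun s => hB s.succ)

end
end SL2Hyper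

theorem proposition3p6_general (p : ℕ) [Fact p.Prime] (k : Type*) [Field k] [CharP k p]
    (r : ℕ) (a : Fin r → ℤ) (j : Fin r → ℚ) :
    (∀ ε δ : Fin r → Fin 2,
      (∀ s, ((Odd p ∧ j s ≠ 0) ∨ (p = 2 ∧ a s ≠ 1)) → ε s = δ s) →
        SL2Hyper.B p k r ε a j = SL2Hyper.B p k r δ a j) ∧
    (∀ ε : Fin r → Fin 2,
      SL2Hyper.B p k r ε a j =
        SL2Hyper.B p k r
          (fun s => if (Odd p ∧ j s ≠ 0) ∨ (p = 2 ∧ a s ≠ 1) then ε s else 0) a j) := by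
  have independence : ∀ ε δ : Fin r → Fin 2,
      (∀ s, ((Odd p ∧ j s ≠ 0) ∨ (p = 2 ∧ a s ≠ 1)) → ε s = δ s) →
        SL2Hyper.B p k r ε a j = SL2Hyper.B p k r δ a j := by
    intro ε δ h
    have free_or_eq (s : Fin r) : SL2Hyper.EpsilonFree p (a s) (j s) ∨ ε s = δ s :=
      (not_or_of_imp (h s)).imp_left SL2Hyper.epsilonFree_iff.2
    refine SL2Hyper.B_congr (fun s => ?_) fun s => ?_
    · exact (free_or_eq s).elim (fun free => free.nNum_eq _ _) fun eq => by rw [eq]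
    · exact (free_or_eq s).elim (fun free => free.B1_eq k _ _) fun eq => by rw [eq]
  exact ⟨independence, fun ε => independence _ _ fun _ hs => (if_pos hs).symm⟩

theorem proposition3p6 (p : ℕ) [Fact p.Prime] (k : Type*) [Field k] [IsAlgClosed k] [CharP k p]
    (r : ℕ) (hr : 0 < r) (a : Fin r → ℤ) (j : Fin r → ℚ)
    (haj : ∀ s, (a s, j s) ∈ SL2Hyper.paramSet p) :
    (∀ ε δ : Fin r → Fin 2,
      (∀ s, ((Odd p ∧ j s ≠ 0) ∨ (p = 2 ∧ a s ≠ 1)) → ε s = δ s) →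
        SL2Hyper.B p k r ε a j = SL2Hyper.B p k r δ a j) ∧
    (∀ ε : Fin r → Fin 2,
      SL2Hyper.B p k r ε a j =
        SL2Hyper.B p k r
          (fun s => if (Odd p ∧ j s ≠ 0) ∨ (p = 2 ∧ a s ≠ 1) then ε s else 0) a j) := by
  exact proposition3p6_general p k r a j
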